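/- Let $\mathbf{Comp}$ be the category of compact Hausdorff spaces and continuous maps. For a compact Hausdorff space $X$, let $C(X)$ be the set of continuous functions $X\to\mathbb R$, with pointwise maximum $\vee$ and minimum $\wedge$, and write $c_X$ for the constant function with value $c$. $J(X)$ is the set of max-min measures on $X$, i.e. of all functionals $\mu\colon C(X)\to\mathbb R$ (not assumed continuous) with $\mu(c_X)=c$, $\mu(\varphi\vee\psi)=\mu(\varphi)\vee\mu(\psi)$ and $\mu(c_X\wedge\varphi)=c\wedge\mu(\varphi)$ for all $c\in\mathbb R$ and $\varphi,\psi\in C(X)$. $I(X)$ is the set of max-plus (idempotent) measures, defined in the same way with the third condition replaced by $\mu(c_X+\varphi)=c+\mu(\varphi)$. Both carry the weak* topology (pointwise convergence on $C(X)$) and are functors $\mathbf{Comp}\to\mathbf{Comp}$ via $J(f)(\mu)(\varphi)=\mu(\varphi\circ f)$ and $I(f)(\mu)(\varphi)=\mu(\varphi\circ f)$. Let $\mathrm{Cone}(X)=(X\times[0,1])/(X\times\{0\})$ with the quotient topology; write $(x,t)$ also for the class of $(x,t)$. A set $A\subset\mathrm{Cone}(X)$ is saturated if $(x,t)\in A$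 and $0\le t'\le t$ imply $(x,t')\in A$. $\bar J(X)$ is the space of all nonempty compact saturated $A\subset\mathrm{Cone}(X)$ that contain $(x,1)$ for some $x\in X$, with the Vietoris topology; it is a functor $\mathbf{Comp}\to\mathbf{Comp}$ via $\bar J(f)(A)=\{(f(x),t)\mid (x,t)\in A\}$. **Proposition.** The functors $J$ and $I$ are naturally isomorphic, through $\bar J$. More precisely: 1. There is a natural isomorphism $g\colon\bar J\to I$ whose components are given by $$g_X(A)(\varphi)=\sup\{\varphi(x)+\ln t\mid (x,t)\in A\}\qquad(\ln 0=-\infty).$$ 2. There are order isomorphisms (equivalently, order-preserving homeomorphisms) $\xi\colon[0,1]\to[-\infty,\infty]$, and for every such $\xi$ there is a natural isomorphism $h\colon\bar J\to J$ whose components are given by $$h_X(A)(\varphi)=\sup\{\xi(t)\wedge\varphi(x)\mid (x,t)\in A\}.$$ 3. Consequently, for every such $\xi$ there is a natural isomorphism $k\colon J\to I$ with $k\circ h=g$. Here isomorphisms are taken in $\mathbf{Comp}$, so that all components are homeomorphisms, and the suprema are taken in $[-\infty,\infty]$. -/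

import Mathlib

open CategoryTheory TopologicalSpace
open scoped unitInterval

universe u

namespace MaxMin

section Measures

variable (X : Type u) [TopologicalSpace X]

/-- Max-min measures: functionals `μ : C(X) → ℝ` that preserve constants, pointwise maxima and
pointwise minima with constants. No continuity is required. -/
structure IsMaxMinMeasure (μ : C(X, ℝ) → ℝ) : Prop where
  map_const : ∀ c : ℝ, μ (ContinuousMap.const X c) = c
  map_sup : ∀ φ ψ : C(X, ℝ), μ (φ ⊔ ψ) = μ φ ⊔ μ ψ
  map_inf : ∀ (c : ℝ) (φ : C(X, ℝ)), μ (ContinuousMap.const X c ⊓ φ) = c ⊓ μ φ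

/-- Max-plus (idempotent) measures: functionals `μ : C(X) → ℝ` that preserve constants, pointwise
maxima and addition of constants. -/
structure IsMaxPlusMeasure (μ : C(X, ℝ) → ℝ) : Prop where
  map_const : ∀ c : ℝ, μ (ContinuousMap.const X c) = c
  map_sup : ∀ φ ψ : C(X, ℝ), μ (φ ⊔ ψ) = μ φ ⊔ μ ψ
  map_add : ∀ (c : ℝ) (φ : C(X, ℝ)), μ (ContinuousMap.const X c + φ) = c + μ φ

/-- The space of max-min measures. As a subtype of the product `C(X) → ℝ` it carries the topology
of pointwise convergence, that is, the weak* topology. -/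
abbrev MaxMinMeasure : Type u := {μ : C(X, ℝ) → ℝ // IsMaxMinMeasure X μ}

/-- The space of max-plus measures with the weak* topology. -/
abbrev MaxPlusMeasure : Type u := {μ : C(X, ℝ) → ℝ // IsMaxPlusMeasure X μ}

variable {X}

/-- A functional that preserves constants and maxima takes values in `[-‖φ‖, ‖φ‖]`. -/
theorem mem_Icc_of_const_sup [CompactSpace X] {μ : C(X, ℝ) → ℝ}
    (hc : ∀ c : ℝ, μ (ContinuousMap.const X c) = c)
    (hs : ∀ φ ψ : C(X, ℝ), μ (φ ⊔ ψ) = μ φ ⊔ μ ψ) (φ : C(X, ℝ)) :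
    μ φ ∈ Set.Icc (-‖φ‖) ‖φ‖ := by
  have mono : ∀ φ ψ : C(X, ℝ), φ ≤ ψ → μ φ ≤ μ ψ := fun φ ψ h => by
    rw [← sup_eq_right.2 h, hs]; exact le_sup_left
  constructor
  · rw [← hc (-‖φ‖)]
    exact mono _ _ fun x => (abs_le.1 (φ.norm_coe_le_norm x)).1
  · rw [← hc ‖φ‖]
    refine (mono _ (ContinuousMap.const X ‖φ‖) fun x => ?_).trans_eq (by simp [hc])
    exact (abs_le.1 (φ.norm_coe_le_norm x)).2

instance [CompactSpace X] : CompactSpace (MaxMinMeasure X) := by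
  refine (isCompact_iff_compactSpace (s := {μ | IsMaxMinMeasure X μ})).1 ?_
  refine (isCompact_univ_pi fun φ : C(X, ℝ) =>
    isCompact_Icc (a := -‖φ‖) (b := ‖φ‖)).of_isClosed_subset ?_
    fun μ h φ _ => mem_Icc_of_const_sup h.map_const h.map_sup φ
  have : {μ : C(X, ℝ) → ℝ | IsMaxMinMeasure X μ} =
      (⋂ c : ℝ, {μ | μ (ContinuousMap.const X c) = c}) ∩
      ((⋂ φ : C(X, ℝ), ⋂ ψ : C(X, ℝ), {μ | μ (φ ⊔ ψ) = μ φ ⊔ μ ψ}) ∩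
      (⋂ c : ℝ, ⋂ φ : C(X, ℝ), {μ | μ (ContinuousMap.const X c ⊓ φ) = c ⊓ μ φ})) := by
    ext μ
    simp only [Set.mem_ofPred_eq, Set.mem_inter_iff, Set.mem_iInter]
    exact ⟨fun h => ⟨h.1, h.2, h.3⟩, fun h => ⟨h.1, h.2.1, h.2.2⟩⟩
  rw [this]
  refine (isClosed_iInter fun c => isClosed_eq (by fun_prop) (by fun_prop)).inter
    ((isClosed_iInter fun φ => isClosed_iInter fun ψ => isClosed_eq (by fun_prop) ?_).inter
      (isClosed_iInter fun c => isClosed_iInter fun φ => isClosed_eq (by fun_prop) ?_))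
  · exact (continuous_apply φ).sup (continuous_apply ψ)
  · exact continuous_const.inf (continuous_apply φ)

instance [CompactSpace X] : CompactSpace (MaxPlusMeasure X) := by
  refine (isCompact_iff_compactSpace (s := {μ | IsMaxPlusMeasure X μ})).1 ?_
  refine (isCompact_univ_pi fun φ : C(X, ℝ) =>
    isCompact_Icc (a := -‖φ‖) (b := ‖φ‖)).of_isClosed_subset ?_
    fun μ h φ _ => mem_Icc_of_const_sup h.map_const h.map_sup φ
  have : {μ : C(X, ℝ) → ℝ | IsMaxPlusMeasure X μ} =
      (⋂ c : ℝ, {μ | μ (ContinuousMap.const X c) = c}) ∩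
      ((⋂ φ : C(X, ℝ), ⋂ ψ : C(X, ℝ), {μ | μ (φ ⊔ ψ) = μ φ ⊔ μ ψ}) ∩
      (⋂ c : ℝ, ⋂ φ : C(X, ℝ), {μ | μ (ContinuousMap.const X c + φ) = c + μ φ})) := by
    ext μ
    simp only [Set.mem_ofPred_eq, Set.mem_inter_iff, Set.mem_iInter]
    exact ⟨fun h => ⟨h.1, h.2, h.3⟩, fun h => ⟨h.1, h.2.1, h.2.2⟩⟩
  rw [this]
  refine (isClosed_iInter fun c => isClosed_eq (by fun_prop) (by fun_prop)).inter
    ((isClosed_iInter fun φ => isClosed_iInter fun ψ => isClosed_eq (by fun_prop) ?_).inter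
      (isClosed_iInter fun c => isClosed_iInter fun φ =>
        isClosed_eq (by fun_prop) (by fun_prop)))
  exact (continuous_apply φ).sup (continuous_apply ψ)

variable {Y : Type u} [TopologicalSpace Y]

/-- Push-forward of max-min measures: `J(f)(μ)(φ) = μ(φ ∘ f)`. -/
def MaxMinMeasure.map (f : C(X, Y)) : C(MaxMinMeasure X, MaxMinMeasure Y) where
  toFun μ := ⟨fun φ => μ.1 (φ.comp f),
    ⟨fun c => μ.2.map_const c, fun φ ψ => μ.2.map_sup (φ.comp f) (ψ.comp f),
      fun c φ => μ.2.map_inf c (φ.comp f)⟩⟩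
  continuous_toFun := Continuous.subtype_mk
    (continuous_pi fun φ => (continuous_apply (φ.comp f)).comp continuous_subtype_val) _

/-- Push-forward of max-plus measures: `I(f)(μ)(φ) = μ(φ ∘ f)`. -/
def MaxPlusMeasure.map (f : C(X, Y)) : C(MaxPlusMeasure X, MaxPlusMeasure Y) where
  toFun μ := ⟨fun φ => μ.1 (φ.comp f),
    ⟨fun c => μ.2.map_const c, fun φ ψ => μ.2.map_sup (φ.comp f) (ψ.comp f),
      fun c φ => μ.2.map_add c (φ.comp f)⟩⟩
  continuous_toFun := Continuous.subtype_mk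
    (continuous_pi fun φ => (continuous_apply (φ.comp f)).comp continuous_subtype_val) _

end Measures

section Cones

variable (X : Type u) [TopologicalSpace X]

/-- The equivalence relation on `X × [0,1]` that collapses `X × {0}` to a point. -/
def coneSetoid : Setoid (X × I) where
  r p q := p = q ∨ (p.2 = 0 ∧ q.2 = 0)
  iseqv :=
    { refl := fun _ => Or.inl rfl
      symm := by
        rintro p q (h | h)
        · exact Or.inl h.symm
        · exact Or.inr h.symm
      trans := by
        rintro p q r (rfl | h) (rfl | h')
        · exact Or.inl rfl
        · exact Or.inr h'
        · exact Or.inr h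
        · exact Or.inr ⟨h.1, h'.2⟩ }

/-- The cone `(X × [0,1]) / (X × {0})`, with the quotient topology. -/
abbrev TopCone : Type u := Quotient (coneSetoid X)

variable {X}

/-- The point `(x, t)` of the cone. -/
def TopCone.mk (x : X) (t : I) : TopCone X := Quotient.mk (coneSetoid X) (x, t)

theorem TopCone.mk_eq_mk {Z : Type u} {x y : Z} {s t : I} :
    TopCone.mk x s = TopCone.mk y t ↔ (x = y ∧ s = t) ∨ (s = 0 ∧ t = 0) := by
  unfold TopCone.mk
  rw [Quotient.eq]
  change ((x, s) = (y, t) ∨ _) ↔ _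
  simp [Prod.ext_iff]

theorem TopCone.continuous_mk : Continuous fun p : X × I => TopCone.mk p.1 p.2 :=
  continuous_quotient_mk'

/-- The map of cones induced by `f`: `(x, t) ↦ (f x, t)`. -/
def TopCone.map {Y : Type u} [TopologicalSpace Y] (f : C(X, Y)) : C(TopCone X, TopCone Y) where
  toFun := Quotient.lift (fun p : X × I => TopCone.mk (f p.1) p.2) (by
    rintro ⟨x, s⟩ ⟨y, t⟩ (h | h)
    · simp_all
    · exact TopCone.mk_eq_mk.2 (Or.inr h))
  continuous_toFun := Continuous.quotient_lift
    (TopCone.continuous_mk.comp (by fun_prop : Continuous fun p : X × I => (f p.1, p.2))) _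

theorem TopCone.map_id : ⇑(TopCone.map (ContinuousMap.id X)) = id := by
  funext p
  induction p using Quotient.inductionOn
  rfl

theorem TopCone.map_comp {Y Z : Type u} [TopologicalSpace Y] [TopologicalSpace Z]
    (f : C(X, Y)) (g : C(Y, Z)) :
    ⇑(TopCone.map (g.comp f)) = TopCone.map g ∘ TopCone.map f := by
  funext p
  induction p using Quotient.inductionOn
  rfl

/-- The map `(x, t) ↦ (x, s * t)` of the cone to itself. -/
def TopCone.shrink (s : I) : C(TopCone X, TopCone X) where
  toFun := Quotient.lift (fun p : X × I => TopCone.mk p.1 (s * p.2)) (by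
    rintro ⟨x, a⟩ ⟨y, b⟩ (h | h)
    · simp_all
    · exact TopCone.mk_eq_mk.2 (Or.inr (by simp_all)))
  continuous_toFun := Continuous.quotient_lift
    (TopCone.continuous_mk.comp (by fun_prop : Continuous fun p : X × I => (p.1, s * p.2))) _

instance [CompactSpace X] [T2Space X] : T2Space (TopCone X) := by
  refine ⟨fun p q hpq => ?_⟩
  induction p using Quotient.inductionOn with | _ p
  induction q using Quotient.inductionOn with | _ q
  obtain ⟨x, s⟩ := p
  obtain ⟨y, t⟩ := q
  by_cases hst : s = t
  · subst hst
    have hxy : x ≠ y := fun h => hpq (by rw [h])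
    have hs : s ≠ 0 := fun h => hpq (TopCone.mk_eq_mk.2 (Or.inr ⟨h, h⟩))
    obtain ⟨f, hfx, hfy, -⟩ := exists_continuous_zero_one_of_isClosed
      (isClosed_singleton (x := x)) (isClosed_singleton (x := y)) (by simpa using hxy)
    have hc : Continuous (Quotient.lift (s := coneSetoid X)
        (fun p : X × I => (p.2 : ℝ) * f p.1) (by
          rintro ⟨x, a⟩ ⟨y, b⟩ (h | h)
          · simp_all
          · simp_all)) := Continuous.quotient_lift (by fun_prop) _
    refine separated_by_continuous hc ?_
    have h1 : f x = 0 := hfx rfl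
    have h2 : f y = 1 := hfy rfl
    change (s : ℝ) * f x ≠ (s : ℝ) * f y
    rw [h1, h2, mul_zero, mul_one]
    exact fun h => hs (Subtype.ext h.symm)
  · have hc : Continuous (Quotient.lift (s := coneSetoid X) (fun p : X × I => p.2) (by
          rintro ⟨x, a⟩ ⟨y, b⟩ (h | h)
          · simp_all
          · simp_all)) := Continuous.quotient_lift (by fun_prop) _
    exact separated_by_continuous hc hst

/-- A subset of the cone is saturated if with `(x, t)` it contains all `(x, t')`, `t' ≤ t`. -/
def IsSaturated (K : Set (TopCone X)) : Prop :=
  ∀ (x : X) (t t' : I), t' ≤ t → TopCone.mk x t ∈ K → TopCone.mk x t' ∈ K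

variable (X) in
/-- The space of nonempty compact saturated subsets of the cone that contain a point `(x, 1)`,
as a subspace of the hyperspace of nonempty compact sets with the Vietoris topology. -/
abbrev SatCompacts : Type u :=
  {A : NonemptyCompacts (TopCone X) //
    IsSaturated (A : Set (TopCone X)) ∧ ∃ x : X, TopCone.mk x 1 ∈ A}

theorem isSaturated_iff_map_le (A : NonemptyCompacts (TopCone X)) :
    IsSaturated (A : Set (TopCone X)) ↔
      ∀ s : I, A.map (TopCone.shrink s) (TopCone.shrink s).continuous ⊔ A = A := by
  simp only [sup_eq_right]
  constructor
  · rintro h s _ ⟨p, hp, rfl⟩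
    induction p using Quotient.inductionOn with | _ p
    exact h p.1 p.2 (s * p.2) unitInterval.mul_le_right hp
  · intro h x t t' htt hx
    by_cases ht : t = 0
    · have : t' = t := le_antisymm htt (ht ▸ unitInterval.nonneg')
      rwa [this]
    · have ht0 : (0 : ℝ) < t := lt_of_le_of_ne t.2.1 fun h => ht (Subtype.ext h.symm)
      refine h ⟨t' / t, div_nonneg t'.2.1 t.2.1, (div_le_one ht0).2 htt⟩ ⟨_, hx, ?_⟩
      change TopCone.mk x _ = _
      congr 1
      exact Subtype.ext (div_mul_cancel₀ _ ht0.ne')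

instance [CompactSpace X] [T2Space X] : CompactSpace (SatCompacts X) := by
  refine (isCompact_iff_compactSpace (s := {A : NonemptyCompacts (TopCone X) |
    IsSaturated (A : Set (TopCone X)) ∧ ∃ x : X, TopCone.mk x 1 ∈ A})).1 (IsClosed.isCompact ?_)
  have : {A : NonemptyCompacts (TopCone X) |
      IsSaturated (A : Set (TopCone X)) ∧ ∃ x : X, TopCone.mk x 1 ∈ A} =
      (⋂ s : I, {A : NonemptyCompacts (TopCone X) | A.map (TopCone.shrink s) (TopCone.shrink s).continuous ⊔ A = A}) ∩
      {A | ((A : Set (TopCone X)) ∩ Set.range fun x : X => TopCone.mk x 1).Nonempty} := by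
    ext A
    simp only [Set.mem_ofPred_eq, Set.mem_inter_iff, Set.mem_iInter, isSaturated_iff_map_le]
    refine and_congr_right fun _ => ⟨?_, ?_⟩
    · rintro ⟨x, hx⟩
      exact ⟨_, hx, x, rfl⟩
    · rintro ⟨_, hx, x, rfl⟩
      exact ⟨x, hx⟩
  rw [this]
  refine (isClosed_iInter fun s => isClosed_eq ?_ continuous_id).inter
    (NonemptyCompacts.isClosed_inter_nonempty_of_isClosed ?_)
  · exact (Continuous.nonemptyCompacts_map (TopCone.shrink s).continuous).sup continuous_id
  · refine (isCompact_range ?_).isClosed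
    exact TopCone.continuous_mk.comp (by fun_prop : Continuous fun x : X => (x, (1 : I)))

theorem map_saturated {Y : Type u} [TopologicalSpace Y] (f : C(X, Y)) (A : SatCompacts X) :
    IsSaturated ((A.1.map (TopCone.map f) (TopCone.map f).continuous : NonemptyCompacts (TopCone Y)) :
      Set (TopCone Y)) := by
  rintro y t t' htt ⟨p, hp, hpy⟩
  induction p using Quotient.inductionOn with | _ p
  obtain ⟨x, s⟩ := p
  change TopCone.mk (f x) s = TopCone.mk y t at hpy
  rcases TopCone.mk_eq_mk.1 hpy with ⟨rfl, rfl⟩ | ⟨rfl, rfl⟩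
  · exact ⟨TopCone.mk x t', A.2.1 x s t' htt hp, rfl⟩
  · have : t' = 0 := le_antisymm htt unitInterval.nonneg'
    subst this
    exact ⟨_, hp, hpy⟩

/-- The image of a saturated set under the map of cones induced by `f`. -/
def SatCompacts.map {Y : Type u} [TopologicalSpace Y] (f : C(X, Y)) :
    C(SatCompacts X, SatCompacts Y) where
  toFun A := ⟨A.1.map (TopCone.map f) (TopCone.map f).continuous, map_saturated f A,
    A.2.2.imp' f fun x hx => ⟨TopCone.mk x 1, hx, rfl⟩⟩
  continuous_toFun := Continuous.subtype_mk
    ((Continuous.nonemptyCompacts_map (TopCone.map f).continuous).comp continuous_subtype_val) _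

end Cones

section Functors

/-- The functor `J` of max-min measures. -/
def maxMinFunctor : CompHaus.{u} ⥤ CompHaus.{u} where
  obj X := CompHaus.of (MaxMinMeasure X)
  map f := CompHausLike.ofHom (fun _ => True) (MaxMinMeasure.map (ConcreteCategory.hom f))
  map_id _ := rfl
  map_comp _ _ := rfl

/-- The functor `I` of max-plus (idempotent) measures. -/
def maxPlusFunctor : CompHaus.{u} ⥤ CompHaus.{u} where
  obj X := CompHaus.of (MaxPlusMeasure X)
  map f := CompHausLike.ofHom (fun _ => True) (MaxPlusMeasure.map (ConcreteCategory.hom f))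
  map_id _ := rfl
  map_comp _ _ := rfl

/-- The functor of saturated compact subsets of the cone. -/
def satFunctor : CompHaus.{u} ⥤ CompHaus.{u} where
  obj X := CompHaus.of (SatCompacts X)
  map f := CompHausLike.ofHom (fun _ => True) (SatCompacts.map (ConcreteCategory.hom f))
  map_id X := by
    refine ConcreteCategory.hom_ext _ _ fun A => Subtype.ext (NonemptyCompacts.ext ?_)
    change TopCone.map (ContinuousMap.id X) '' (A.1 : Set (TopCone X)) = A.1
    rw [TopCone.map_id, Set.image_id]
  map_comp {X Y Z} f g := by
    refine ConcreteCategory.hom_ext _ _ fun A => Subtype.ext (NonemptyCompacts.ext ?_)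
    let F : C(X, Y) := ConcreteCategory.hom f
    let G : C(Y, Z) := ConcreteCategory.hom g
    change TopCone.map (G.comp F) '' (A.1 : Set (TopCone X)) =
      TopCone.map G '' (TopCone.map F '' A.1)
    rw [TopCone.map_comp, Set.image_comp]

end Functors

end MaxMin

/-!
A saturated compact set `A` in the cone over `X` plays the role of an upper semicontinuous density
`X → [0,1]` with maximal value `1`, and both kinds of measures arise by "integrating" against it.
What the two cases share is isolated in the structure `Scaling`: a family of functions
`θ t : ℝ → [-∞, ∞]` interpolating monotonically and continuously between `θ 0 = -∞` and
`θ 1 = id`. For max-plus measures `θ t r = r + ln t`, for max-min measures `θ t r = ξ t ⊓ r`.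
The integral of `φ` is the maximum over `A` of the continuous function `(x, t) ↦ θ t (φ x)`.

* The maximum depends continuously on `A`, directly from the definition of the Vietoris topology
  (`Scaling.continuous_integral`).
* `A` can be recovered as the set of points `(x, t)` with `θ t (ψ x) ≤ ∫ ψ` for all `ψ`: a point
  outside `A` is detected by an Urysohn function peaking at `x`
  (`Scaling.mem_of_forall_eval_le`).
* Conversely a functional `μ` preserving constants and maxima defines a compact saturated set by
  this formula. It represents `μ` as soon as any failure `θ t (φ x) < μ φ` on the fibre over `x` is
  witnessed by a function `ψ` with `φ x < ψ x` and `μ ψ < μ φ`: by compactness finitely many such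
  `ψ` have a maximum dominating `φ`, which is absurd (`Scaling.exists_integral_eq`). The witness is
  a translate of a function violating the defining inequality of the set in the max-plus case, and
  an Urysohn function supported in one of its superlevel sets in the max-min case.

The components are thus continuous bijections between compact Hausdorff spaces, hence isomorphisms,
and naturality is the change of variables formula `Scaling.integral_map`.
-/

namespace MaxMin

/-! ### Scalings and functions on the cone -/

/-- A monotone continuous family of functions `ℝ → [-∞, ∞]`, indexed by `[0,1]`, that joins the
constant `-∞` to the identity and separates the parameters. -/
structure Scaling where
  /-- The family of functions. -/
  toFun : I → ℝ → EReal
  continuous_uncurry : Continuous fun p : I × ℝ => toFun p.1 p.2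
  mono : ∀ {s t : I} {q r : ℝ}, s ≤ t → q ≤ r → toFun s q ≤ toFun t r
  zero : ∀ r, toFun 0 r = ⊥
  one : ∀ r, toFun 1 r = r
  strict : ∀ {s t : I}, s < t → ∃ a, toFun s a < toFun t a

namespace Scaling

variable (θ : Scaling)

theorem le_self (t : I) (r : ℝ) : θ.toFun t r ≤ r :=
  (θ.mono unitInterval.le_one' le_rfl).trans_eq (θ.one r)

theorem map_sup (t : I) (q r : ℝ) : θ.toFun t (q ⊔ r) = θ.toFun t q ⊔ θ.toFun t r :=
  Monotone.map_sup (fun _ _ h => θ.mono le_rfl h) q r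

theorem eq_one_of_forall_le {t : I} (h : ∀ c : ℝ, (c : EReal) ≤ θ.toFun t c) : t = 1 := by
  by_contra ht
  obtain ⟨a, ha⟩ := θ.strict (lt_of_le_of_ne unitInterval.le_one' ht)
  exact ((h a).trans_lt ha).ne (θ.one a).symm

section Topology

variable {X : Type u} [TopologicalSpace X]

/-- The function `(x, t) ↦ θ t (φ x)` on the cone. -/
def eval (φ : C(X, ℝ)) : TopCone X → EReal :=
  Quotient.lift (fun p : X × I => θ.toFun p.2 (φ p.1)) (by
    rintro ⟨x, s⟩ ⟨y, t⟩ (h | h)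
    · rw [h]
    · simp_all [θ.zero])

theorem eval_mk (φ : C(X, ℝ)) (x : X) (t : I) :
    θ.eval φ (TopCone.mk x t) = θ.toFun t (φ x) := rfl

theorem continuous_eval (φ : C(X, ℝ)) : Continuous (θ.eval φ) :=
  Continuous.quotient_lift
    (θ.continuous_uncurry.comp (by fun_prop : Continuous fun p : X × I => (p.2, φ p.1))) _

theorem eval_mono {φ ψ : C(X, ℝ)} (h : φ ≤ ψ) (p : TopCone X) : θ.eval φ p ≤ θ.eval ψ p := by
  induction p using Quotient.inductionOn with | _ p
  exact θ.mono le_rfl (h p.1)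

theorem eval_sup (φ ψ : C(X, ℝ)) (p : TopCone X) :
    θ.eval (φ ⊔ ψ) p = θ.eval φ p ⊔ θ.eval ψ p := by
  induction p using Quotient.inductionOn with | _ p
  exact θ.map_sup p.2 _ _

theorem eval_map {Y : Type u} [TopologicalSpace Y] (f : C(X, Y)) (φ : C(Y, ℝ)) (p : TopCone X) :
    θ.eval φ (TopCone.map f p) = θ.eval (φ.comp f) p := by
  induction p using Quotient.inductionOn with | _ p
  rfl

/-! ### The functional of a saturated set -/

/-- The maximum of `(x, t) ↦ θ t (φ x)` over a saturated set. The supremum is always a real number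
(`Scaling.isGreatest_integral`), so that nothing is lost in `EReal.toReal`. -/
noncomputable def integral (A : SatCompacts X) (φ : C(X, ℝ)) : ℝ :=
  (sSup (θ.eval φ '' (A.1 : Set (TopCone X)))).toReal

theorem isGreatest_integral (A : SatCompacts X) (φ : C(X, ℝ)) :
    IsGreatest (θ.eval φ '' (A.1 : Set (TopCone X))) (θ.integral A φ) := by
  obtain ⟨p, hp, hmax⟩ :=
    A.1.isCompact.exists_isMaxOn A.1.nonempty (θ.continuous_eval φ).continuousOn
  have hG : IsGreatest (θ.eval φ '' (A.1 : Set (TopCone X))) (θ.eval φ p) :=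
    ⟨⟨p, hp, rfl⟩, by rintro _ ⟨q, hq, rfl⟩; exact hmax hq⟩
  have hbot : θ.eval φ p ≠ ⊥ := by
    obtain ⟨x, hx⟩ := A.2.2
    have h := hG.2 ⟨_, hx, rfl⟩
    rw [eval_mk, θ.one] at h
    exact ((EReal.bot_lt_coe _).trans_le h).ne'
  have htop : θ.eval φ p ≠ ⊤ := by
    clear hp hmax hG hbot
    induction p using Quotient.inductionOn with | _ p
    exact ((θ.le_self p.2 (φ p.1)).trans_lt (EReal.coe_lt_top _)).ne
  rw [integral, hG.csSup_eq, EReal.coe_toReal htop hbot]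
  exact hG

theorem integral_eq_of_isGreatest {A : SatCompacts X} {φ : C(X, ℝ)} {c : ℝ}
    (h : IsGreatest (θ.eval φ '' (A.1 : Set (TopCone X))) c) : θ.integral A φ = c :=
  EReal.coe_injective ((θ.isGreatest_integral A φ).unique h)

theorem coe_integral (A : SatCompacts X) (φ : C(X, ℝ)) :
    (θ.integral A φ : EReal) =
      sSup {r : EReal | ∃ (x : X) (t : I), TopCone.mk x t ∈ A.1 ∧ r = θ.toFun t (φ x)} := by
  rw [← (θ.isGreatest_integral A φ).csSup_eq]
  congr 1
  ext r
  constructor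
  · rintro ⟨p, hp, rfl⟩
    induction p using Quotient.inductionOn with | _ p
    exact ⟨p.1, p.2, hp, rfl⟩
  · rintro ⟨x, t, h, rfl⟩
    exact ⟨_, h, rfl⟩

theorem integral_const (A : SatCompacts X) (c : ℝ) :
    θ.integral A (ContinuousMap.const X c) = c := by
  refine θ.integral_eq_of_isGreatest ⟨?_, ?_⟩
  · obtain ⟨x, hx⟩ := A.2.2
    exact ⟨_, hx, θ.one c⟩
  · rintro _ ⟨p, -, rfl⟩
    induction p using Quotient.inductionOn with | _ p
    exact θ.le_self p.2 c

/-- The integral commutes with monotone operations applied to the values of `θ.eval φ`. -/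
theorem integral_eq_of_eval_eq (A : SatCompacts X) {φ ψ : C(X, ℝ)} {F : EReal → EReal} {c : ℝ}
    (hF : Monotone F) (h : ∀ p, θ.eval ψ p = F (θ.eval φ p)) (hc : F (θ.integral A φ) = c) :
    θ.integral A ψ = c := by
  refine θ.integral_eq_of_isGreatest ?_
  have h' : θ.eval ψ = F ∘ θ.eval φ := funext h
  rw [h', Set.image_comp, ← hc]
  exact hF.map_isGreatest (θ.isGreatest_integral A φ)

theorem integral_sup (A : SatCompacts X) (φ ψ : C(X, ℝ)) :
    θ.integral A (φ ⊔ ψ) = θ.integral A φ ⊔ θ.integral A ψ := by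
  have hmono : ∀ {φ ψ : C(X, ℝ)}, φ ≤ ψ → θ.integral A φ ≤ θ.integral A ψ := by
    intro φ ψ h
    obtain ⟨p, hp, hpφ⟩ := (θ.isGreatest_integral A φ).1
    rw [← EReal.coe_le_coe_iff, ← hpφ]
    exact (θ.eval_mono h p).trans ((θ.isGreatest_integral A ψ).2 ⟨p, hp, rfl⟩)
  refine le_antisymm ?_ (sup_le (hmono le_sup_left) (hmono le_sup_right))
  obtain ⟨p, hp, h⟩ := (θ.isGreatest_integral A (φ ⊔ ψ)).1
  rw [eval_sup] at h
  rw [← EReal.coe_le_coe_iff, ← h, EReal.coe_strictMono.monotone.map_max]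
  exact sup_le_sup ((θ.isGreatest_integral A φ).2 ⟨p, hp, rfl⟩)
    ((θ.isGreatest_integral A ψ).2 ⟨p, hp, rfl⟩)

theorem integral_map {Y : Type u} [TopologicalSpace Y] (f : C(X, Y)) (A : SatCompacts X)
    (φ : C(Y, ℝ)) : θ.integral (SatCompacts.map f A) φ = θ.integral A (φ.comp f) := by
  refine θ.integral_eq_of_isGreatest ?_
  change IsGreatest (θ.eval φ '' (TopCone.map f '' (A.1 : Set (TopCone X)))) _
  rw [Set.image_image]
  simp_rw [eval_map]
  exact θ.isGreatest_integral A (φ.comp f)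

theorem continuous_integral (φ : C(X, ℝ)) :
    Continuous fun A : SatCompacts X => θ.integral A φ := by
  rw [OrderTopology.continuous_iff]
  intro a
  constructor
  · have : (fun A : SatCompacts X => θ.integral A φ) ⁻¹' Set.Ioi a = Subtype.val ⁻¹'
        {A : NonemptyCompacts (TopCone X) |
          ((A : Set (TopCone X)) ∩ θ.eval φ ⁻¹' Set.Ioi (a : EReal)).Nonempty} := by
      ext A
      simp only [Set.mem_preimage, Set.mem_Ioi, Set.mem_ofPred_eq]
      rw [← EReal.coe_lt_coe_iff]
      constructor
      · intro h
        obtain ⟨p, hp, hpφ⟩ := (θ.isGreatest_integral A φ).1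
        exact ⟨p, hp, h.trans_eq hpφ.symm⟩
      · rintro ⟨p, hp, h⟩
        exact lt_of_lt_of_le h ((θ.isGreatest_integral A φ).2 ⟨p, hp, rfl⟩)
    rw [this]
    exact (NonemptyCompacts.isOpen_inter_nonempty_of_isOpen
      (isOpen_Ioi.preimage (θ.continuous_eval φ))).preimage continuous_subtype_val
  · have : (fun A : SatCompacts X => θ.integral A φ) ⁻¹' Set.Iio a = Subtype.val ⁻¹'
        {A : NonemptyCompacts (TopCone X) |
          (A : Set (TopCone X)) ⊆ θ.eval φ ⁻¹' Set.Iio (a : EReal)} := by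
      ext A
      simp only [Set.mem_preimage, Set.mem_Iio, Set.mem_ofPred_eq]
      rw [← EReal.coe_lt_coe_iff]
      constructor
      · intro h p hp
        exact lt_of_le_of_lt ((θ.isGreatest_integral A φ).2 ⟨p, hp, rfl⟩) h
      · intro h
        obtain ⟨p, hp, hpφ⟩ := (θ.isGreatest_integral A φ).1
        exact hpφ.symm.trans_lt (h hp)
    rw [this]
    exact (NonemptyCompacts.isOpen_subsets_of_isOpen
      (isOpen_Iio.preimage (θ.continuous_eval φ))).preimage continuous_subtype_val

end Topology

end Scaling

/-! ### Recovering a saturated set from its functional -/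

section Compact

variable {X : Type u} [TopologicalSpace X] [CompactSpace X]

theorem exists_continuousMap_peak [T2Space X] {x : X} {U : Set X} (hU : IsOpen U)
    (hx : x ∈ U) {a b : ℝ} (hab : b ≤ a) : ∃ φ : C(X, ℝ), φ x = a ∧ (∀ y, φ y ≤ a) ∧ ∀ y ∉ U, φ y = b := by
  obtain ⟨f, hf0, hf1, hf⟩ := exists_continuous_zero_one_of_isClosed hU.isClosed_compl
    (isClosed_singleton (x := x)) (by simpa using hx)
  refine ⟨ContinuousMap.const X b + (a - b) • f, ?_, fun y => ?_, fun y hy => ?_⟩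
  · have : f x = 1 := hf1 rfl
    simp [this]
  · have := mul_le_mul_of_nonneg_left (hf y).2 (sub_nonneg.2 hab)
    simp only [ContinuousMap.add_apply, ContinuousMap.const_apply, ContinuousMap.smul_apply,
      smul_eq_mul]
    linarith
  · have : f y = 0 := hf0 hy
    simp [this]

namespace Scaling

variable (θ : Scaling)

theorem mem_of_forall_eval_le [T2Space X] (B : SatCompacts X) (p : TopCone X)
    (h : ∀ φ : C(X, ℝ), θ.eval φ p ≤ θ.integral B φ) : p ∈ B.1 := by
  by_contra hp
  induction p using Quotient.inductionOn with | _ p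
  obtain ⟨x, t⟩ := p
  change TopCone.mk x t ∉ B.1 at hp
  have ht : 0 < t := by
    refine lt_of_le_of_ne unitInterval.nonneg' fun ht => hp ?_
    obtain ⟨y, hy⟩ := B.2.2
    have h0 : TopCone.mk y 0 = TopCone.mk x t := TopCone.mk_eq_mk.2 (Or.inr ⟨rfl, ht.symm⟩)
    rw [← h0]
    exact B.2.1 y 1 0 unitInterval.nonneg' hy
  -- Near `x` the set `B` stays below some level `s < t`.
  obtain ⟨U, s, hU, hxU, hst, hUs⟩ : ∃ (U : Set X) (s : I), IsOpen U ∧ x ∈ U ∧ s < t ∧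
      ∀ y ∈ U, ∀ r, TopCone.mk y r ∈ B.1 → r ≤ s := by
    have hopen : IsOpen {q : X × I | TopCone.mk q.1 q.2 ∉ B.1} :=
      B.1.isCompact.isClosed.isOpen_compl.preimage TopCone.continuous_mk
    obtain ⟨U, V, hU, hxU, hV, htV, hUV⟩ := mem_nhds_prod_iff'.1 (hopen.mem_nhds hp)
    obtain ⟨s, hst, hs⟩ := exists_Ioc_subset_of_mem_nhds (hV.mem_nhds htV) ⟨0, ht⟩
    refine ⟨U, s, hU, hxU, hst, fun y hy r hr => ?_⟩
    by_contra! hsr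
    have hmem : (y, r ⊓ t) ∈ U ×ˢ V := ⟨hy, hs ⟨lt_inf_iff.2 ⟨hsr, hst⟩, inf_le_right⟩⟩
    exact hUV hmem (B.2.1 y r _ inf_le_left hr)
  obtain ⟨a, ha⟩ := θ.strict hst
  obtain ⟨b, -, hb⟩ := EReal.lt_iff_exists_real_btwn.1 (bot_le.trans_lt ha)
  obtain ⟨φ, hφx, hφa, hφb⟩ := exists_continuousMap_peak hU hxU
    (EReal.coe_lt_coe_iff.1 (hb.trans_le (θ.le_self t a))).le
  obtain ⟨q, hq, hqφ⟩ := (θ.isGreatest_integral B φ).1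
  have hle := h φ
  rw [← hqφ] at hle
  refine hle.not_gt ?_
  clear hle hqφ
  induction q using Quotient.inductionOn with | _ q
  obtain ⟨y, r⟩ := q
  change θ.toFun r (φ y) < θ.toFun t (φ x)
  rw [hφx]
  by_cases hy : y ∈ U
  · exact (θ.mono (hUs y hy r hq) (hφa y)).trans_lt ha
  · rw [hφb y hy]
    exact (θ.le_self r b).trans_lt hb

theorem integral_injective [T2Space X] {A B : SatCompacts X}
    (h : ∀ φ : C(X, ℝ), θ.integral A φ = θ.integral B φ) : A = B := by
  refine Subtype.ext (NonemptyCompacts.ext (Set.Subset.antisymm (fun p hp => ?_) fun p hp => ?_))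
  · exact θ.mem_of_forall_eval_le B p fun φ =>
      h φ ▸ (θ.isGreatest_integral A φ).2 ⟨p, hp, rfl⟩
  · exact θ.mem_of_forall_eval_le A p fun φ =>
      h φ ▸ (θ.isGreatest_integral B φ).2 ⟨p, hp, rfl⟩

/-! ### Representing a functional by a saturated set -/

/-- The representing set consists of all `(x, t)` with `θ t (ψ x) ≤ μ ψ` for every `ψ`. By `hwit`,
if the fibre of this set over `x` is too small for the value `μ φ` to be attained there, then near
`x` the function `φ` is dominated by some `ψ` with `μ ψ < μ φ`. -/
theorem exists_integral_eq {μ : C(X, ℝ) → ℝ}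
    (hconst : ∀ c : ℝ, μ (ContinuousMap.const X c) = c)
    (hsup : ∀ φ ψ : C(X, ℝ), μ (φ ⊔ ψ) = μ φ ⊔ μ ψ)
    (hwit : ∀ (φ : C(X, ℝ)) (x : X),
      (∀ t : I, (∀ ψ : C(X, ℝ), θ.toFun t (ψ x) ≤ μ ψ) → θ.toFun t (φ x) < μ φ) →
      ∃ ψ : C(X, ℝ), φ x < ψ x ∧ μ ψ < μ φ) :
    ∃ A : SatCompacts X, θ.integral A = μ := by
  have hmono : ∀ φ ψ : C(X, ℝ), φ ≤ ψ → μ φ ≤ μ ψ := fun φ ψ h => by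
    rw [← sup_eq_right.2 h, hsup]; exact le_sup_left
  let S : Set (TopCone X) := {p | ∀ ψ : C(X, ℝ), θ.eval ψ p ≤ μ ψ}
  have hS : IsCompact S := by
    have : S = ⋂ ψ : C(X, ℝ), {p | θ.eval ψ p ≤ μ ψ} := by ext p; simp [S]
    rw [this]
    exact (isClosed_iInter fun ψ => isClosed_le (θ.continuous_eval ψ) continuous_const).isCompact
  have hattain : ∀ φ : C(X, ℝ), ∃ p ∈ S, (μ φ : EReal) ≤ θ.eval φ p := by
    intro φ
    by_contra! hlt
    obtain ⟨ψ, hψ, hψμ⟩ : ∃ ψ : C(X, ℝ), (∀ x ∈ Set.univ, φ x ≤ ψ x) ∧ μ ψ < μ φ := by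
      refine isCompact_univ.induction_on
        (p := fun V => ∃ ψ : C(X, ℝ), (∀ x ∈ V, φ x ≤ ψ x) ∧ μ ψ < μ φ) ?_ ?_ ?_ ?_
      · exact ⟨ContinuousMap.const X (μ φ - 1), by simp, by rw [hconst]; linarith⟩
      · rintro V W hVW ⟨ψ, h, hμ⟩
        exact ⟨ψ, fun x hx => h x (hVW hx), hμ⟩
      · rintro V W ⟨ψ, h, hμ⟩ ⟨ψ', h', hμ'⟩
        refine ⟨ψ ⊔ ψ', ?_, by rw [hsup]; exact sup_lt_iff.2 ⟨hμ, hμ'⟩⟩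
        rintro x (hx | hx)
        · exact (h x hx).trans le_sup_left
        · exact (h' x hx).trans le_sup_right
      · intro x _
        obtain ⟨ψ, hx, hμ⟩ := hwit φ x fun t ht => hlt (TopCone.mk x t) ht
        exact ⟨{y | φ y < ψ y}, mem_nhdsWithin_of_mem_nhds
          ((isOpen_lt φ.continuous ψ.continuous).mem_nhds hx), ψ, fun y hy => hy.le, hμ⟩
    exact (hmono φ ψ fun x => hψ x trivial).not_gt hψμ
  have hSne : S.Nonempty := (hattain 0).imp fun _ h => h.1
  -- The largest `t` occurring in the set satisfies `c ≤ θ t c` for all constants `c`.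
  have hone : ∃ x : X, TopCone.mk x 1 ∈ S := by
    have hlevel : Continuous (Quotient.lift (s := coneSetoid X) (fun p : X × I => p.2) (by
        rintro ⟨x, a⟩ ⟨y, b⟩ (h | h)
        · simp_all
        · simp_all)) := Continuous.quotient_lift (by fun_prop) _
    obtain ⟨p, hp, hmax⟩ := hS.exists_isMaxOn hSne hlevel.continuousOn
    induction p using Quotient.inductionOn with | _ p
    obtain ⟨x, t⟩ := p
    have ht : t = 1 := by
      refine θ.eq_one_of_forall_le fun c => ?_
      obtain ⟨q, hq, hc⟩ := hattain (ContinuousMap.const X c)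
      have hle := hmax hq
      clear hq
      induction q using Quotient.inductionOn with | _ q
      rw [hconst] at hc
      exact hc.trans (θ.mono hle le_rfl)
    exact ⟨x, ht ▸ hp⟩
  refine ⟨⟨⟨⟨S, hS⟩, hSne⟩, fun x t t' htt h ψ => (θ.mono htt le_rfl).trans (h ψ), hone⟩,
    funext fun φ => θ.integral_eq_of_isGreatest ⟨?_, ?_⟩⟩
  · obtain ⟨p, hp, h⟩ := hattain φ
    exact ⟨p, hp, le_antisymm (hp φ) h⟩
  · rintro _ ⟨p, hp, rfl⟩
    exact hp φ

end Scaling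

end Compact

/-! ### The max-plus scaling -/

/-- The scaling `θ t r = r + ln t`, with `ln 0 = -∞`. -/
noncomputable def plusScaling : Scaling where
  toFun t r := (r : EReal) + ENNReal.log (ENNReal.ofReal (t : ℝ))
  continuous_uncurry := by
    refine continuous_iff_continuousAt.2 fun p => ?_
    have hadd := EReal.continuousAt_add
      (p := ((p.2 : EReal), ENNReal.log (ENNReal.ofReal (p.1 : ℝ))))
      (Or.inl (EReal.coe_ne_top _)) (Or.inl (EReal.coe_ne_bot _))
    exact hadd.comp (f := fun p : I × ℝ =>
      ((p.2 : EReal), ENNReal.log (ENNReal.ofReal (p.1 : ℝ))))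
      ((continuous_coe_real_ereal.comp continuous_snd).prodMk
        (ENNReal.continuous_log.comp (ENNReal.continuous_ofReal.comp
          (continuous_subtype_val.comp continuous_fst)))).continuousAt
  mono hst hqr := add_le_add (EReal.coe_le_coe_iff.2 hqr)
    (ENNReal.log_le_log (ENNReal.ofReal_le_ofReal hst))
  zero r := by simp
  one r := by simp
  strict {s t} hst := by
    refine ⟨0, ?_⟩
    rw [EReal.coe_zero, zero_add, zero_add]
    exact ENNReal.log_lt_log ((ENNReal.ofReal_lt_ofReal_iff (s.2.1.trans_lt hst)).2 hst)

variable {X : Type u} [TopologicalSpace X]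

theorem isMaxPlusMeasure_integral (A : SatCompacts X) :
    IsMaxPlusMeasure X (plusScaling.integral A) where
  map_const := plusScaling.integral_const A
  map_sup := plusScaling.integral_sup A
  map_add c φ := by
    refine plusScaling.integral_eq_of_eval_eq A (φ := φ) (F := fun r => (c : EReal) + r)
      (fun _ _ h => add_le_add le_rfl h) (fun p => ?_) (EReal.coe_add _ _).symm
    induction p using Quotient.inductionOn with | _ p
    change ((c + φ p.1 : ℝ) : EReal) + _ = c + ((φ p.1 : EReal) + _)
    rw [EReal.coe_add, add_assoc]

theorem IsMaxPlusMeasure.exists_integral_eq [CompactSpace X] {μ : C(X, ℝ) → ℝ}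
    (hμ : IsMaxPlusMeasure X μ) : ∃ A : SatCompacts X, plusScaling.integral A = μ := by
  refine plusScaling.exists_integral_eq hμ.map_const hμ.map_sup fun φ x h => ?_
  rcases lt_or_ge (φ x) (μ φ) with hlt | hge
  · obtain ⟨c, hc, hc'⟩ := exists_between hlt
    exact ⟨ContinuousMap.const X c, hc, by rwa [hμ.map_const]⟩
  -- The level at which `φ x + ln t = μ φ`.
  let t : I := ⟨Real.exp (μ φ - φ x), (Real.exp_pos _).le, Real.exp_le_one_iff.2 (by linarith)⟩
  have ht : ∀ r : ℝ, plusScaling.toFun t r = ((r + (μ φ - φ x) : ℝ) : EReal) := by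
    intro r
    change (r : EReal) + ENNReal.log (ENNReal.ofReal (Real.exp (μ φ - φ x))) = _
    rw [ENNReal.log_ofReal_of_pos (Real.exp_pos _), Real.log_exp, EReal.coe_add]
  have hnot : ¬ ∀ ψ : C(X, ℝ), plusScaling.toFun t (ψ x) ≤ μ ψ := by
    intro hψ
    have := h t hψ
    rw [ht, EReal.coe_lt_coe_iff] at this
    linarith
  push Not at hnot
  obtain ⟨ψ, hψ⟩ := hnot
  rw [ht, EReal.coe_lt_coe_iff] at hψ
  obtain ⟨c, hc, hc'⟩ := exists_between (show φ x - ψ x < μ φ - μ ψ by linarith)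
  refine ⟨ContinuousMap.const X c + ψ, ?_, ?_⟩
  · simp only [ContinuousMap.add_apply, ContinuousMap.const_apply]
    linarith
  · rw [hμ.map_add]
    linarith

/-! ### The max-min scaling -/

/-- The scaling `θ t r = ξ t ⊓ r`. -/
noncomputable def minScaling (ξ : I ≃o EReal) : Scaling where
  toFun t r := ξ t ⊓ (r : EReal)
  continuous_uncurry := (ξ.continuous.comp continuous_fst).inf
    (continuous_coe_real_ereal.comp continuous_snd)
  mono hst hqr := inf_le_inf (ξ.monotone hst) (EReal.coe_le_coe_iff.2 hqr)
  zero r := by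
    have : ξ 0 = ⊥ := ξ.map_bot
    simp [this]
  one r := by
    have : ξ 1 = ⊤ := ξ.map_top
    simp [this]
  strict {s t} hst := by
    obtain ⟨a, hsa, hat⟩ := EReal.lt_iff_exists_real_btwn.1 (ξ.strictMono hst)
    exact ⟨a, by rw [inf_eq_left.2 hsa.le, inf_eq_right.2 hat.le]; exact hsa⟩

theorem isMaxMinMeasure_integral (ξ : I ≃o EReal) (A : SatCompacts X) :
    IsMaxMinMeasure X ((minScaling ξ).integral A) where
  map_const := (minScaling ξ).integral_const A
  map_sup := (minScaling ξ).integral_sup A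
  map_inf c φ := by
    refine (minScaling ξ).integral_eq_of_eval_eq A (φ := φ) (F := fun r => (c : EReal) ⊓ r)
      (fun _ _ h => inf_le_inf le_rfl h) (fun p => ?_) EReal.coe_strictMono.monotone.map_min.symm
    induction p using Quotient.inductionOn with | _ p
    change ξ p.2 ⊓ ((c ⊓ φ p.1 : ℝ) : EReal) = (c : EReal) ⊓ (ξ p.2 ⊓ (φ p.1 : EReal))
    rw [EReal.coe_strictMono.monotone.map_min]
    exact inf_left_comm _ _ _

/-- If `μ ψ < d`, then a function that is arbitrarily large at a point of `{d < ψ}` but small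
outside this set has measure at most `μ ψ`. -/
theorem IsMaxMinMeasure.exists_large_value [CompactSpace X] [T2Space X] {μ : C(X, ℝ) → ℝ}
    (hμ : IsMaxMinMeasure X μ) {ψ : C(X, ℝ)} {x : X} (hx : μ ψ < ψ x) (M : ℝ) :
    ∃ φ : C(X, ℝ), M ≤ φ x ∧ μ φ ≤ μ ψ := by
  obtain ⟨d, hd, hdx⟩ := exists_between hx
  obtain ⟨φ, hφx, -, hφ⟩ := exists_continuousMap_peak
    (isOpen_lt continuous_const ψ.continuous : IsOpen {y | d < ψ y}) hdx
    (le_max_right M (-‖ψ‖))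
  refine ⟨φ, hφx ▸ le_max_left _ _, ?_⟩
  have hle : ContinuousMap.const X d ⊓ φ ≤ ψ := by
    intro y
    by_cases hy : d < ψ y
    · exact inf_le_left.trans hy.le
    · refine inf_le_right.trans ?_
      rw [hφ y hy]
      exact (abs_le.1 (ψ.norm_coe_le_norm y)).1
  have hμle : d ⊓ μ φ ≤ μ ψ := by
    rw [← hμ.map_inf, ← sup_eq_right.2 hle, hμ.map_sup]
    exact le_sup_left
  exact (inf_le_iff.1 hμle).resolve_left hd.not_ge

theorem IsMaxMinMeasure.exists_integral_eq [CompactSpace X] [T2Space X] (ξ : I ≃o EReal)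
    {μ : C(X, ℝ) → ℝ} (hμ : IsMaxMinMeasure X μ) :
    ∃ A : SatCompacts X, (minScaling ξ).integral A = μ := by
  refine (minScaling ξ).exists_integral_eq hμ.map_const hμ.map_sup fun φ x h => ?_
  rcases lt_or_ge (φ x) (μ φ) with hlt | hge
  · obtain ⟨c, hc, hc'⟩ := exists_between hlt
    exact ⟨ContinuousMap.const X c, hc, by rwa [hμ.map_const]⟩
  -- The level at which `ξ t ⊓ φ x = μ φ`.
  have ht : ∀ r : ℝ, (minScaling ξ).toFun (ξ.symm (μ φ)) r = ((μ φ ⊓ r : ℝ) : EReal) := by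
    intro r
    change ξ (ξ.symm (μ φ)) ⊓ (r : EReal) = _
    rw [ξ.apply_symm_apply, EReal.coe_strictMono.monotone.map_min]
  have hnot : ¬ ∀ ψ : C(X, ℝ), (minScaling ξ).toFun (ξ.symm (μ φ)) (ψ x) ≤ μ ψ := by
    intro hψ
    have := h _ hψ
    rw [ht, EReal.coe_lt_coe_iff, inf_eq_left.2 hge] at this
    exact this.false
  push Not at hnot
  obtain ⟨ψ, hψ⟩ := hnot
  rw [ht, EReal.coe_lt_coe_iff, lt_inf_iff] at hψ
  obtain ⟨χ, hχx, hχ⟩ := hμ.exists_large_value hψ.2 (φ x + 1)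
  exact ⟨χ, by linarith, hχ.trans_lt hψ.1⟩

/-! ### The natural isomorphisms -/

/-- The natural isomorphism `A ↦ (φ ↦ max {φ x + ln t | (x, t) ∈ A})`. -/
noncomputable def satIsoMaxPlus : satFunctor.{u} ≅ maxPlusFunctor.{u} :=
  NatIso.ofComponents
    (fun X => CompHausLike.isoOfBijective (X := satFunctor.obj X) (Y := maxPlusFunctor.obj X)
      (CompHausLike.ofHom (fun _ => True)
        (⟨fun A => ⟨plusScaling.integral A, isMaxPlusMeasure_integral A⟩,
          Continuous.subtype_mk (continuous_pi fun φ => plusScaling.continuous_integral φ) _⟩ :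
          C(SatCompacts X, MaxPlusMeasure X)))
      ⟨fun _ _ h => plusScaling.integral_injective fun φ => congrFun (congrArg Subtype.val h) φ,
        fun μ => (IsMaxPlusMeasure.exists_integral_eq μ.2).imp fun _ h => Subtype.ext h⟩)
    (fun {X Y} f => ConcreteCategory.hom_ext _ _ fun A => Subtype.ext (funext fun φ =>
      plusScaling.integral_map (ConcreteCategory.hom f : C(X, Y)) A φ))

/-- The natural isomorphism `A ↦ (φ ↦ max {ξ t ⊓ φ x | (x, t) ∈ A})`. -/
noncomputable def satIsoMaxMin (ξ : I ≃o EReal) : satFunctor.{u} ≅ maxMinFunctor.{u} :=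
  NatIso.ofComponents
    (fun X => CompHausLike.isoOfBijective (X := satFunctor.obj X) (Y := maxMinFunctor.obj X)
      (CompHausLike.ofHom (fun _ => True)
        (⟨fun A => ⟨(minScaling ξ).integral A, isMaxMinMeasure_integral ξ A⟩,
          Continuous.subtype_mk (continuous_pi fun φ => (minScaling ξ).continuous_integral φ) _⟩ :
          C(SatCompacts X, MaxMinMeasure X)))
      ⟨fun _ _ h => (minScaling ξ).integral_injective fun φ =>
          congrFun (congrArg Subtype.val h) φ,
        fun μ => (IsMaxMinMeasure.exists_integral_eq ξ μ.2).imp fun _ h => Subtype.ext h⟩)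
    (fun {X Y} f => ConcreteCategory.hom_ext _ _ fun A => Subtype.ext (funext fun φ =>
      (minScaling ξ).integral_map (ConcreteCategory.hom f : C(X, Y)) A φ))

/-- An order isomorphism from `[0,1]` onto `[-∞, ∞]`, through `[0, ∞]`. -/
noncomputable def unitIntervalOrderIsoEReal : I ≃o EReal :=
  ENNReal.orderIsoUnitIntervalBirational.symm.trans ENNReal.logOrderIso

end MaxMin

theorem mainTheorem1 :
    Nonempty (MaxMin.maxMinFunctor.{u} ≅ MaxMin.maxPlusFunctor.{u}) ∧
    Nonempty (I ≃o EReal) ∧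
    ∃ g : MaxMin.satFunctor.{u} ≅ MaxMin.maxPlusFunctor.{u},
      (∀ (X : CompHaus.{u}) (A : MaxMin.SatCompacts X) (φ : C(X, ℝ)),
        (((g.hom.app X A : MaxMin.MaxPlusMeasure X).val φ : ℝ) : EReal) =
          sSup {r : EReal | ∃ (x : X) (t : I), MaxMin.TopCone.mk x t ∈ A.val ∧
            r = ((φ x : ℝ) : EReal) + ENNReal.log (ENNReal.ofReal (t : ℝ))}) ∧
      ∀ ξ : I ≃o EReal,
        ∃ (h : MaxMin.satFunctor.{u} ≅ MaxMin.maxMinFunctor.{u})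
          (k : MaxMin.maxMinFunctor.{u} ≅ MaxMin.maxPlusFunctor.{u}),
          (∀ (X : CompHaus.{u}) (A : MaxMin.SatCompacts X) (φ : C(X, ℝ)),
            (((h.hom.app X A : MaxMin.MaxMinMeasure X).val φ : ℝ) : EReal) =
              sSup {r : EReal | ∃ (x : X) (t : I), MaxMin.TopCone.mk x t ∈ A.val ∧
                r = ξ t ⊓ ((φ x : ℝ) : EReal)}) ∧
          h ≪≫ k = g := by
  refine ⟨⟨(MaxMin.satIsoMaxMin MaxMin.unitIntervalOrderIsoEReal).symm ≪≫ MaxMin.satIsoMaxPlus⟩,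
    ⟨MaxMin.unitIntervalOrderIsoEReal⟩, MaxMin.satIsoMaxPlus,
    fun X A φ => MaxMin.plusScaling.coe_integral A φ, fun ξ =>
      ⟨MaxMin.satIsoMaxMin ξ, (MaxMin.satIsoMaxMin ξ).symm ≪≫ MaxMin.satIsoMaxPlus,
        fun X A φ => (MaxMin.minScaling ξ).coe_integral A φ, ?_⟩⟩
  exact Iso.self_symm_id_assoc _ _
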